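/- **Conventions.** A polynomial $W\in\mathbb C[x_1,\dots,x_N]$ is *admissible* if the origin is an isolated critical point of $W$ and there is a unique vector $(q_1,\dots,q_N)$ of positive rational numbers (the *weights* of $W$) such that $\sum_i a_iq_i=1$ for every monomial $x^a$ occurring in $W$. An admissible $W$ is *noninvertible* if it has more than $N$ monomials. Put $$G_W^{\max}=\{\zeta\in(\mathbb C^\times)^N : W(\zeta_1x_1,\dots,\zeta_Nx_N)=W(x_1,\dots,x_N)\},\qquad J=(e^{2\pi i q_1},\dots,e^{2\pi i q_N})\in G_W^{\max},$$ and let $\mathcal Q_W=\mathbb C[x_1,\dots,x_N]/(\partial_1W,\dots,\partial_NW)$. For $g=(e^{2\pi i g_1},\dots,e^{2\pi i g_N})$ with $0\le g_i<1$, let $\mathrm{fix}(g)=\{x_i : g_i=0\}$ and let $W|_{\mathrm{fix}(g)}$ be the polynomial in the variables $\mathrm{fix}(g)$ obtained from $W$ by setting the other variables to $0$. A group element $h$ acts on $\mathcal Q_{W|_{\mathrm{fix}(g)}}$ by $m\mapsto \det(h|_{\mathrm{fix}(g)})\,(m\circ h)$. For admissible $W$ let $$\mathcal A_{W,G}=\bigoplus_{g\in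 G}\bigl(\mathcal Q_{W|_{\mathrm{fix}(g)}}\bigr)^{G}\quad\text{with the $g$-summand in degree}\quad \#\mathrm{fix}(g)+2\sum_i(g_i-q_i),$$ for $G=G_W^{\max}$, and $\mathcal B_{W,\{0\}}=\mathcal Q_W$ with $x^a$ in degree $2\sum_i a_iq_i$. Below, $\cong$ means isomorphism of graded vector spaces over $\mathbb C$. **Corollary.** 1. Let $n>3$ and let $W$ be a noninvertible admissible polynomial in two variables with weights $(\frac1n,\frac1n)$ and $G_W^{\max}=\langle J\rangle$. Then there is no admissible polynomial $W^T$ in two variables with $\mathcal A_{W,G_W^{\max}}\cong\mathcal B_{W^T,\{0\}}$. 2. For every $n\ge 3$ the polynomial $W'=x^n+y^n+x^{n-1}y$ is admissible and noninvertible, has weights $(\frac1n,\frac1n)$, and satisfies $G_{W'}^{\max}=\langle J\rangle$. 3. Consequently the following conjecture is false: for every $N$ and every admissible polynomial $W$ in $N$ variables there is an admissible polynomial $W^T$ in $N$ variables with $\mathcal A_{W,G_W^{\max}}\cong\mathcal B_{W^T,\{0\}}$. -/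

import Mathlib

open MvPolynomial Filter Topology

noncomputable section

namespace LandauGinzburg

section Polynomials

variable {σ : Type} [Fintype σ]

/-- `W` has an isolated critical point at the origin. -/
def IsNondegenerate (W : MvPolynomial σ ℂ) : Prop :=
  (∀ i, eval 0 (pderiv i W) = 0) ∧
    ∀ᶠ x in 𝓝[≠] (0 : σ → ℂ), ∃ i, eval x (pderiv i W) ≠ 0

/-- `q` is a vector of quasihomogeneous weights of `W`: the `q i` are positive rationals, and
every monomial of `W` has weighted degree `1`. -/
def HasWeights (W : MvPolynomial σ ℂ) (q : σ → ℚ) : Prop :=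
  (∀ i, 0 < q i) ∧ IsWeightedHomogeneous q W 1

/-- `W` is nondegenerate and quasihomogeneous with unique weights. -/
def IsAdmissible (W : MvPolynomial σ ℂ) : Prop :=
  IsNondegenerate W ∧ ∃! q : σ → ℚ, HasWeights W q

/-- The unique weights of an admissible polynomial. -/
def IsAdmissible.weights {W : MvPolynomial σ ℂ} (hW : IsAdmissible W) : σ → ℚ :=
  hW.2.choose

/-- An admissible polynomial is noninvertible if it has more monomials than variables. -/
def IsNoninvertible (W : MvPolynomial σ ℂ) : Prop :=
  IsAdmissible W ∧ Fintype.card σ < W.support.card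

end Polynomials

section Symmetries

variable {σ : Type}

/-- The substitution `f(x) ↦ f(ζ x)` by a diagonal map `ζ`. -/
def diagSubst (ζ : σ → ℂˣ) : MvPolynomial σ ℂ →ₐ[ℂ] MvPolynomial σ ℂ :=
  aeval fun i => C (ζ i : ℂ) * X i

theorem diagSubst_mul (ζ ξ : σ → ℂˣ) (f : MvPolynomial σ ℂ) :
    diagSubst (ζ * ξ) f = diagSubst ζ (diagSubst ξ f) := by
  have h : diagSubst (ζ * ξ) = (diagSubst ζ).comp (diagSubst ξ) := by
    apply MvPolynomial.algHom_ext
    intro i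
    simp [diagSubst, MvPolynomial.algHom_C, mul_assoc, mul_left_comm]
  rw [h]; rfl

theorem diagSubst_one (f : MvPolynomial σ ℂ) : diagSubst (1 : σ → ℂˣ) f = f := by
  have h : diagSubst (1 : σ → ℂˣ) = AlgHom.id ℂ (MvPolynomial σ ℂ) := by
    apply MvPolynomial.algHom_ext
    intro i
    simp [diagSubst]
  rw [h]; rfl

/-- The maximal diagonal symmetry group: all `ζ ∈ (ℂˣ)^σ` with `W(ζ x) = W(x)`. -/
def maxSymmetryGroup (W : MvPolynomial σ ℂ) : Subgroup (σ → ℂˣ) where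
  carrier := {ζ | diagSubst ζ W = W}
  one_mem' := diagSubst_one W
  mul_mem' := by
    intro a b ha hb
    change diagSubst (a * b) W = W
    rw [diagSubst_mul, show diagSubst b W = W from hb, show diagSubst a W = W from ha]
  inv_mem' := by
    intro a ha
    change diagSubst a⁻¹ W = W
    conv_lhs => rw [← show diagSubst a W = W from ha]
    rw [← diagSubst_mul, inv_mul_cancel, diagSubst_one]

/-- The diagonal element `(exp(2πi q_1), …, exp(2πi q_n))` with phases `q mod ℤ`. For `q` the
weights of `W` this is the exponential grading element `J`. -/
def expElement (q : σ → ℚ) : σ → ℂˣ := fun i =>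
  Units.mk0 (Complex.exp (2 * Real.pi * Complex.I * (q i : ℂ))) (Complex.exp_ne_zero _)

/-- The phase `θ ∈ [0, 1)` of a complex number `z = exp(2πi θ)` of modulus one. -/
def phase (z : ℂˣ) : ℝ := Int.fract (Complex.arg z / (2 * Real.pi))

theorem phase_spec (z : ℂˣ) (hz : ‖(z : ℂ)‖ = 1) :
    0 ≤ phase z ∧ phase z < 1 ∧ Complex.exp (2 * Real.pi * Complex.I * (phase z : ℂ)) = z := by
  refine ⟨Int.fract_nonneg _, Int.fract_lt_one _, ?_⟩
  have h1 : (phase z : ℂ) = (Complex.arg z / (2 * Real.pi) : ℂ)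
      - (⌊Complex.arg (z : ℂ) / (2 * Real.pi)⌋ : ℂ) := by
    rw [phase, Int.fract]; push_cast; rfl
  have hpi : (Real.pi : ℂ) ≠ 0 := by exact_mod_cast Real.pi_ne_zero
  have h2 : (2 * Real.pi * Complex.I * (phase z : ℂ) : ℂ) = Complex.arg z * Complex.I
      - (⌊Complex.arg (z : ℂ) / (2 * Real.pi)⌋ : ℂ) * (2 * Real.pi * Complex.I) := by
    rw [h1]; field_simp
  rw [h2, Complex.exp_sub, Complex.exp_int_mul_two_pi_mul_I, div_one]
  have h3 := Complex.norm_mul_exp_arg_mul_I (z : ℂ)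
  rwa [hz, Complex.ofReal_one, one_mul] at h3

end Symmetries

section MilnorRing

variable {σ : Type}

/-- The ideal generated by the partial derivatives of `W`. -/
def jacobianIdeal (W : MvPolynomial σ ℂ) : Ideal (MvPolynomial σ ℂ) :=
  Ideal.span (Set.range fun i => pderiv i W)

/-- The Milnor ring `ℂ[x] / (∂W/∂x_1, …, ∂W/∂x_n)`. -/
abbrev MilnorRing (W : MvPolynomial σ ℂ) : Type :=
  MvPolynomial σ ℂ ⧸ jacobianIdeal W

theorem pderiv_diagSubst (ζ : σ → ℂˣ) (i : σ) (f : MvPolynomial σ ℂ) :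
    pderiv i (diagSubst ζ f) = C (ζ i : ℂ) * diagSubst ζ (pderiv i f) := by
  classical
  induction f using MvPolynomial.induction_on with
  | C a => simp [diagSubst]
  | add p q hp hq => simp only [map_add, hp, hq, mul_add]
  | mul_X p j hp =>
    have hX : diagSubst ζ (X j) = C (ζ j : ℂ) * X j := by simp [diagSubst]
    simp only [map_mul, Derivation.leibniz, smul_eq_mul, map_add, hp, hX, pderiv_C, pderiv_X]
    by_cases h : i = j
    · subst h; simp; ring
    · simp [Pi.single_eq_of_ne' h]; ring

theorem jacobianIdeal_le_comap (W : MvPolynomial σ ℂ) (ζ : maxSymmetryGroup W) :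
    jacobianIdeal W ≤ (jacobianIdeal W).comap (diagSubst ζ.1) := by
  rw [jacobianIdeal, Ideal.span_le]
  rintro _ ⟨i, rfl⟩
  have hW : diagSubst ζ.1 W = W := ζ.2
  have h1 := pderiv_diagSubst ζ.1 i W
  rw [hW] at h1
  have h2 : diagSubst ζ.1 (pderiv i W) = C (((ζ.1 i)⁻¹ : ℂˣ) : ℂ) * pderiv i W := by
    conv_rhs => rw [h1, ← mul_assoc, ← C_mul, Units.inv_mul, C_1, one_mul]
  change diagSubst ζ.1 (pderiv i W) ∈ jacobianIdeal W
  rw [h2]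
  exact Ideal.mul_mem_left _ _ (Ideal.subset_span ⟨i, rfl⟩)

/-- The action `m ↦ det(ζ) · (m ∘ ζ)` of a diagonal symmetry `ζ` of `W` on the Milnor ring. -/
def milnorAction [Fintype σ] (W : MvPolynomial σ ℂ) (ζ : maxSymmetryGroup W) :
    MilnorRing W →ₗ[ℂ] MilnorRing W :=
  (∏ i, (ζ.1 i : ℂ)) •
    (Ideal.quotientMapₐ (jacobianIdeal W) (diagSubst ζ.1)
      (jacobianIdeal_le_comap W ζ)).toLinearMap

end MilnorRing

section FixedLocus

variable {σ : Type} [Fintype σ]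

open scoped Classical in
/-- The variables fixed by the diagonal map `g` (those with phase zero). -/
def fixedLocus (g : σ → ℂˣ) : Finset σ := Finset.univ.filter fun i => g i = 1

open scoped Classical in
/-- Restriction of polynomials to the fixed locus of `g`: the other variables are set to `0`. -/
def restrictFix (g : σ → ℂˣ) : MvPolynomial σ ℂ →ₐ[ℂ] MvPolynomial (fixedLocus g) ℂ :=
  aeval fun i => if h : i ∈ fixedLocus g then X ⟨i, h⟩ else 0

/-- A diagonal symmetry of `W` restricts to a diagonal symmetry of `W|_{fix(g)}`. -/
def restrictSymmetry (W : MvPolynomial σ ℂ) (g : σ → ℂˣ) (h : maxSymmetryGroup W) :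
    maxSymmetryGroup (restrictFix g W) :=
  ⟨fun i => h.1 i, by
    have hcomp : (diagSubst fun i : fixedLocus g => h.1 i).comp (restrictFix g)
        = (restrictFix g).comp (diagSubst h.1) := by
      apply MvPolynomial.algHom_ext
      intro i
      by_cases hi : i ∈ fixedLocus g <;> simp [diagSubst, restrictFix, hi, MvPolynomial.algHom_C]
    have h1 := DFunLike.congr_fun hcomp W
    have h2 : diagSubst h.1 W = W := h.2
    simp only [AlgHom.comp_apply, h2] at h1
    exact h1⟩

end FixedLocus

section Models

variable {σ : Type} [Fintype σ]

/-- The `g`-sector of the A-model: the `G`-invariants of the Milnor ring of `W|_{fix(g)}`. -/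
def sector (W : MvPolynomial σ ℂ) (G : Subgroup (maxSymmetryGroup W)) (g : σ → ℂˣ) :
    Submodule ℂ (MilnorRing (restrictFix g W)) where
  carrier := {m | ∀ h ∈ G, milnorAction (restrictFix g W) (restrictSymmetry W g h) m = m}
  zero_mem' := fun h _ => map_zero _
  add_mem' := fun ha hb h hh => by rw [map_add, ha h hh, hb h hh]
  smul_mem' := fun c m hm h hh => by rw [map_smul, hm h hh]

/-- The state space `𝒜_{W,G} = ⨁_{g ∈ G} (𝒬_{W|fix(g)})^G` of the A-model, for a group `G` of
diagonal symmetries of `W`. The full group `G_W^max` is `G = ⊤`. -/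
abbrev AModel (W : MvPolynomial σ ℂ) (G : Subgroup (maxSymmetryGroup W)) : Type :=
  DirectSum G fun g => sector W G (g.1.1)

/-- The A-model degree `dim fix(g) + 2 ∑ (g_i - q_i)` of every element of the `g`-sector,
where `g_i ∈ [0, 1)` are the phases of `g`. -/
def aDegree (q : σ → ℚ) (g : σ → ℂˣ) : ℝ :=
  (fixedLocus g).card + 2 * ∑ i, (phase (g i) - (q i : ℝ))

/-- The degree `d` piece of the A-model of an admissible polynomial: the sum of the sectors of
degree `d`. -/
def aGrading {W : MvPolynomial σ ℂ} (hW : IsAdmissible W) (G : Subgroup (maxSymmetryGroup W))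
    (d : ℝ) : Submodule ℂ (AModel W G) where
  carrier := {x | ∀ g : G, x g ≠ 0 → aDegree hW.weights g.1.1 = d}
  zero_mem' := fun g hg => absurd rfl hg
  add_mem' := by
    intro x y hx hy g hg
    by_cases h : x g = 0
    · refine hy g fun h' => hg ?_
      rw [DirectSum.add_apply, h, h', add_zero]
    · exact hx g h
  smul_mem' := by
    intro c x hx g hg
    refine hx g fun h => hg ?_
    rw [DirectSum.smul_apply, h, smul_zero]

/-- The unorbifolded B-model `ℬ_{W,{0}}`, i.e. the Milnor ring of `W`. -/
abbrev BModel (W : MvPolynomial σ ℂ) : Type := MilnorRing W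

/-- The degree `d` piece of the unorbifolded B-model of an admissible polynomial: the span of
the monomials `x^a` with `2 ∑ a_i q_i = d`. -/
def bGrading {W : MvPolynomial σ ℂ} (hW : IsAdmissible W) (d : ℝ) : Submodule ℂ (BModel W) :=
  Submodule.span ℂ
    {m | ∃ a : σ →₀ ℕ, 2 * ∑ i, (a i : ℝ) * (hW.weights i : ℝ) = d ∧
      m = Ideal.Quotient.mk (jacobianIdeal W) (monomial a 1)}

/-- Isomorphism of graded vector spaces: a linear isomorphism which carries the degree `d` piece
onto the degree `d` piece, for every `d`. -/
def GradedIso {V V' : Type} [AddCommMonoid V] [Module ℂ V] [AddCommMonoid V'] [Module ℂ V']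
    (A : ℝ → Submodule ℂ V) (B : ℝ → Submodule ℂ V') : Prop :=
  ∃ e : V ≃ₗ[ℂ] V', ∀ d, (A d).map e.toLinearMap = B d

/-- `𝒜_{W,G_W^max} ≅ ℬ_{W',{0}}` as graded vector spaces. -/
def IsMirror {W W' : MvPolynomial σ ℂ} (hW : IsAdmissible W) (hW' : IsAdmissible W') : Prop :=
  GradedIso (aGrading hW ⊤) (bGrading hW')

end Models

end LandauGinzburg

end

open MvPolynomial Filter Topology

noncomputable section

namespace LandauGinzburg

/-! ### Jacobian ideals of homogeneous polynomials, diagonal actions and phases. -/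

section General

variable {σ : Type}

/-! The obstruction is a count in the single degree `2 - 4 / n`, combined with a gap in the degrees
near `0`.

On the A-side, `W` is homogeneous of degree `n`, and every symmetry is a scalar `n`-th root of unity
`z`. The identity sector sits in degree `2 - 4 / n`. A monomial of degree `n - 2` is invariant
there, since the determinant supplies the missing factor `z ^ 2`; the Jacobian ideal starts in
degree `n - 1`, so these `n - 1` monomials stay independent (`exists_linearIndependent_aGrading`).
The sector of phase `r / n` with `0 < r < n` has degree `4 (r - 1) / n`, so for `n > 3` no positive
degree below `4 / n` occurs (`four_div_le_aDegree`).

On the B-side, a graded isomorphism would carry this gap over, so every variable with nonzero class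
has degree at least `4 / n`. A nonzero monomial of degree `2 - 4 / n` then has first exponent at
most `n / 2 - 1`, and this exponent determines the monomial. The piece has dimension at most `n / 2
< n - 1` (`card_le_of_linearIndependent_bGrading`), a contradiction. The explicit family with `n =
4` then refutes the conjecture. -/

theorem IsAdmissible.hasWeights [Fintype σ] {W : MvPolynomial σ ℂ} (hW : IsAdmissible W) :
    HasWeights W hW.weights :=
  hW.2.choose_spec.1

theorem IsAdmissible.weights_eq [Fintype σ] {W : MvPolynomial σ ℂ} (hW : IsAdmissible W)
    {q : σ → ℚ} (hq : HasWeights W q) : hW.weights = q :=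
  (hW.2.choose_spec.2 q hq).symm

theorem isHomogeneous_of_weights {W : MvPolynomial σ ℂ} {n : ℕ} (hn : n ≠ 0)
    (hW : IsWeightedHomogeneous (fun _ : σ => 1 / (n : ℚ)) W 1) : W.IsHomogeneous n := by
  intro d hd
  have h := hW hd
  have hn' : (n : ℚ) ≠ 0 := by exact_mod_cast hn
  rw [Finsupp.weight_apply, Finsupp.sum] at h
  simp only [nsmul_eq_mul, mul_one_div] at h
  rw [← Finset.sum_div, div_eq_one_iff_eq hn'] at h
  rw [Finsupp.weight_apply, Finsupp.sum]
  simp only [Pi.one_apply, smul_eq_mul, mul_one]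
  exact_mod_cast h

/-- The generators are homogeneous of degree `n - 1`, and multiplying by polynomials never lowers
the lowest degree. The bound is written `m.degree + 1 < n` to avoid truncated subtraction. -/
theorem coeff_eq_zero_of_mem_jacobianIdeal {W : MvPolynomial σ ℂ} {n : ℕ}
    (hW : W.IsHomogeneous n) {p : MvPolynomial σ ℂ} (hp : p ∈ jacobianIdeal W) (m : σ →₀ ℕ)
    (hm : m.degree + 1 < n) : coeff m p = 0 := by
  classical
  induction hp using Submodule.span_induction generalizing m with
  | mem x hx =>
    obtain ⟨i, rfl⟩ := hx
    refine hW.pderiv.coeff_eq_zero ?_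
    omega
  | zero => simp
  | add x y _ _ hx hy => rw [coeff_add, hx m hm, hy m hm, add_zero]
  | smul a x _ hx =>
    rw [smul_eq_mul, coeff_mul]
    refine Finset.sum_eq_zero fun u hu => ?_
    rw [hx u.2, mul_zero]
    have h := congrArg Finsupp.degree (Finset.HasAntidiagonal.mem_antidiagonal.1 hu)
    rw [map_add] at h
    omega

theorem linearIndependent_mk_monomial {W : MvPolynomial σ ℂ} {n : ℕ} (hW : W.IsHomogeneous n)
    {ι : Type} {a : ι → σ →₀ ℕ} (ha : Function.Injective a) (hd : ∀ i, (a i).degree + 1 < n) :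
    LinearIndependent ℂ fun i => Ideal.Quotient.mk (jacobianIdeal W) (monomial (a i) 1) := by
  classical
  rw [linearIndependent_iff']
  intro s c hc i hi
  have h1 : Ideal.Quotient.mk (jacobianIdeal W) (∑ j ∈ s, c j • monomial (a j) 1) = 0 := by
    rw [map_sum, ← hc]
    rfl
  have h2 := coeff_eq_zero_of_mem_jacobianIdeal hW (Ideal.Quotient.eq_zero_iff_mem.1 h1) (a i) (hd i)
  rw [coeff_sum] at h2
  simpa [coeff_smul, coeff_monomial, ha.eq_iff, hi] using h2

theorem diagSubst_monomial (ζ : σ → ℂˣ) (a : σ →₀ ℕ) (c : ℂ) :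
    diagSubst ζ (monomial a c) = monomial a (c * a.prod fun i k => (ζ i : ℂ) ^ k) := by
  rw [diagSubst, aeval_monomial]
  conv_rhs => rw [monomial_eq]
  simp only [mul_pow, Finsupp.prod_mul, algebraMap_eq, map_mul, mul_assoc]
  congr 2
  simp [Finsupp.prod, map_prod]

theorem coeff_diagSubst (ζ : σ → ℂˣ) (f : MvPolynomial σ ℂ) (a : σ →₀ ℕ) :
    coeff a (diagSubst ζ f) = coeff a f * a.prod fun i k => (ζ i : ℂ) ^ k := by
  classical
  induction f using MvPolynomial.induction_on' with
  | monomial u c =>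
    rw [diagSubst_monomial, coeff_monomial, coeff_monomial]
    split_ifs with h
    · rw [h]
    · simp
  | add p q hp hq => rw [map_add, coeff_add, hp, hq, coeff_add, add_mul]

/-- Monomials are eigenvectors of the diagonal action, so invariance reduces to the eigenvalue,
determinant factor included, being `1`. -/
theorem mk_monomial_mem_sector [Fintype σ] {W : MvPolynomial σ ℂ}
    {G : Subgroup (maxSymmetryGroup W)} {g : σ → ℂˣ} {a : fixedLocus g →₀ ℕ}
    (ha : ∀ h ∈ G, (∏ i : fixedLocus g, (h.1 i : ℂ)) * a.prod (fun i k => (h.1 i : ℂ) ^ k) = 1) :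
    Ideal.Quotient.mk (jacobianIdeal (restrictFix g W)) (monomial a 1) ∈ sector W G g := by
  intro h hh
  have h1 : milnorAction (restrictFix g W) (restrictSymmetry W g h)
      (Ideal.Quotient.mk (jacobianIdeal (restrictFix g W)) (monomial a 1)) =
      (∏ i : fixedLocus g, (h.1 i : ℂ)) • Ideal.Quotient.mk (jacobianIdeal (restrictFix g W))
        (diagSubst (fun i : fixedLocus g => h.1 i) (monomial a 1)) := rfl
  rw [h1, diagSubst_monomial, one_mul]
  have h2 : ∀ c d : ℂ, c • Ideal.Quotient.mk (jacobianIdeal (restrictFix g W)) (monomial a d) =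
      Ideal.Quotient.mk (jacobianIdeal (restrictFix g W)) (c • monomial a d) := fun _ _ => rfl
  rw [h2, smul_monomial, smul_eq_mul, ha h hh]

theorem isHomogeneous_restrictFix [Fintype σ] {W : MvPolynomial σ ℂ} {n : ℕ}
    (hW : W.IsHomogeneous n) (g : σ → ℂˣ) : (restrictFix g W).IsHomogeneous n := by
  rw [← one_mul n, restrictFix]
  refine MvPolynomial.IsHomogeneous.aeval hW _ fun i => ?_
  split_ifs
  · exact isHomogeneous_X _ _
  · exact isHomogeneous_zero _ _ _

theorem phase_one : phase 1 = 0 := by simp [phase]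

theorem fixedLocus_one [Fintype σ] : fixedLocus (1 : σ → ℂˣ) = Finset.univ := by
  simp [fixedLocus]

theorem exists_phase_eq {z : ℂˣ} {n : ℕ} (hn : n ≠ 0) (hz : z ^ n = 1) :
    ∃ r : ℕ, phase z = r / n := by
  have hz' : (z : ℂ) ^ n = 1 := by rw [← Units.val_pow_eq_pow_val, hz, Units.val_one]
  obtain ⟨h0, -, he⟩ := phase_spec z (Complex.norm_eq_one_of_pow_eq_one hz' hn)
  rw [← he, ← Complex.exp_nat_mul, Complex.exp_eq_one_iff] at hz'
  obtain ⟨k, hk⟩ := hz'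
  have hne : (2 * Real.pi * Complex.I : ℂ) ≠ 0 := Complex.two_pi_I_ne_zero
  have h1 : (n * phase z : ℂ) = k := by
    apply mul_right_cancel₀ hne
    rw [← hk]; ring
  have h2 : n * phase z = (k : ℝ) := by exact_mod_cast h1
  have hk0 : 0 ≤ k := by
    have : (0 : ℝ) ≤ k := h2 ▸ mul_nonneg (Nat.cast_nonneg n) h0
    exact_mod_cast this
  lift k to ℕ using hk0
  refine ⟨k, ?_⟩
  have hn' : (n : ℝ) ≠ 0 := by exact_mod_cast hn
  rw [eq_div_iff hn', mul_comm, h2, Int.cast_natCast]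

theorem eq_one_of_phase_eq_zero {z : ℂˣ} (hz : ‖(z : ℂ)‖ = 1) (h : phase z = 0) : z = 1 := by
  have he := (phase_spec z hz).2.2
  rw [h] at he
  simpa using he.symm

theorem exists_eq_const_of_mem_zpowers {n : ℕ} (hn : n ≠ 0) {ζ : σ → ℂˣ}
    (h : ζ ∈ Subgroup.zpowers (expElement fun _ : σ => 1 / (n : ℚ))) :
    ∃ z : ℂˣ, z ^ n = 1 ∧ ζ = fun _ => z := by
  obtain ⟨k, rfl⟩ := Subgroup.mem_zpowers_iff.1 h
  set w : ℂˣ := Units.mk0 (Complex.exp (2 * Real.pi * Complex.I * ((1 / (n : ℚ) : ℚ) : ℂ)))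
    (Complex.exp_ne_zero _) with hw
  have hwn : w ^ n = 1 := by
    have hn' : (n : ℂ) ≠ 0 := by exact_mod_cast hn
    ext
    rw [hw, Units.val_pow_eq_pow_val, Units.val_mk0, ← Complex.exp_nat_mul, Units.val_one,
      ← Complex.exp_two_pi_mul_I]
    congr 1
    push_cast
    field_simp
  refine ⟨w ^ k, ?_, ?_⟩
  · rw [← zpow_natCast, ← zpow_mul, mul_comm, zpow_mul, zpow_natCast, hwn, one_zpow]
  · funext i
    rw [Pi.pow_apply]
    rfl

end General

/-! ### Two variables: degree gap, dimension bounds and nonexistence of a mirror. -/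

section TwoVariables

theorem four_div_le_aDegree {n : ℕ} (hn : 3 < n) {z : ℂˣ} (hz : z ^ n = 1)
    (hpos : 0 < aDegree (fun _ : Fin 2 => 1 / (n : ℚ)) fun _ => z) :
    4 / (n : ℝ) ≤ aDegree (fun _ : Fin 2 => 1 / (n : ℚ)) fun _ => z := by
  have hn4 : (4 : ℝ) ≤ n := by exact_mod_cast hn
  have hn0 : (0 : ℝ) < n := by linarith
  have h4 : 4 / (n : ℝ) ≤ 1 := (div_le_one hn0).2 hn4
  obtain ⟨r, hr⟩ := exists_phase_eq (by omega) hz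
  have hdeg : aDegree (fun _ : Fin 2 => 1 / (n : ℚ)) (fun _ => z) =
      (fixedLocus fun _ : Fin 2 => z).card + (r - 1 : ℝ) * (4 / n) := by
    rw [aDegree, Fin.sum_univ_two, hr]
    push_cast
    ring
  rw [hdeg] at hpos ⊢
  have hc0 : (0 : ℝ) ≤ (fixedLocus fun _ : Fin 2 => z).card := Nat.cast_nonneg _
  have h40 : 0 < 4 / (n : ℝ) := by positivity
  rcases r with _ | _ | r
  -- Phase `0` is the identity sector, of degree `2 - 4 / n`; this is at least `4 / n` exactly
  -- because `n ≥ 4`.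
  · have hz' : (z : ℂ) ^ n = 1 := by rw [← Units.val_pow_eq_pow_val, hz, Units.val_one]
    have h1 : z = 1 := eq_one_of_phase_eq_zero
      (Complex.norm_eq_one_of_pow_eq_one hz' (by omega)) (by simpa using hr)
    have h2 : (fixedLocus fun _ : Fin 2 => z).card = 2 := by
      rw [h1, show (fun _ : Fin 2 => (1 : ℂˣ)) = 1 from rfl, fixedLocus_one]
      rfl
    rw [h2]
    push_cast
    linarith
  -- For `r = 1` the degree equals the number of fixed variables, so positivity already makes it at
  -- least `1 ≥ 4 / n`.
  · simp only [zero_add, Nat.cast_one, sub_self, zero_mul, add_zero] at hpos ⊢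
    have : 0 < (fixedLocus fun _ : Fin 2 => z).card := by exact_mod_cast hpos
    have : (1 : ℝ) ≤ (fixedLocus fun _ : Fin 2 => z).card := by exact_mod_cast this
    linarith
  · have : (0 : ℝ) ≤ r * (4 / n) := by positivity
    push_cast
    linarith

/-- A family of monomials of the same degree `2 - 4 / n` in a two-variable Milnor ring without
nonzero elements of degree strictly between `0` and `4 / n` spans a space of dimension at most
`n / 2`, since the exponent of the first variable determines the monomial. -/
theorem card_le_of_linearIndependent_bGrading {n : ℕ} (hn : 3 < n) {W : MvPolynomial (Fin 2) ℂ}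
    (hW : IsAdmissible W) (hdeg : ∀ d : ℝ, 0 < d → bGrading hW d ≠ ⊥ → 4 / (n : ℝ) ≤ d)
    {m : ℕ} {v : Fin m → BModel W} (hv : LinearIndependent ℂ v)
    (hmem : ∀ i, v i ∈ bGrading hW (2 - 4 / n)) : m ≤ n / 2 := by
  classical
  have hn0 : (0 : ℝ) < n := by exact_mod_cast (by omega : 0 < n)
  have hq : ∀ i, (0 : ℝ) < (hW.weights i : ℝ) := fun i => by exact_mod_cast hW.hasWeights.1 i
  set P : ℕ → (Fin 2 →₀ ℕ) → Prop := fun c a =>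
    a 0 = c ∧ 2 * ∑ i, (a i : ℝ) * (hW.weights i : ℝ) = 2 - 4 / n with hP
  -- At most one exponent satisfies `P c`, since the second weight is nonzero; `f c` is the class of
  -- that monomial, or `0` if there is none.
  set f : ℕ → BModel W := fun c =>
    if h : ∃ a, P c a then Ideal.Quotient.mk (jacobianIdeal W) (monomial h.choose 1) else 0 with hf
  have hspan : Set.range v ≤ Submodule.span ℂ
      (((Finset.range (n / 2)).image f : Finset (BModel W)) : Set (BModel W)) := by
    rintro _ ⟨i, rfl⟩
    refine (Submodule.span_le.2 ?_ : bGrading hW (2 - 4 / n) ≤ _) (hmem i)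
    rintro _ ⟨a, ha, rfl⟩
    by_cases hzero : Ideal.Quotient.mk (jacobianIdeal W) (monomial a 1) = 0
    · rw [hzero]
      exact Submodule.zero_mem _
    have hle : a 0 < n / 2 := by
      -- The class of `X 0` may vanish, and then its weight is not controlled by the gap; but a
      -- nonzero class divisible by `X 0` forces `X 0` to be nonzero.
      rcases Nat.eq_zero_or_pos (a 0) with h0 | h0
      · omega
      have hX : Ideal.Quotient.mk (jacobianIdeal W) (X 0) ≠ 0 := by
        intro h
        apply hzero
        have h1 : (monomial a (1 : ℂ)) = X 0 * monomial (a - Finsupp.single 0 1) 1 := by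
          rw [X, monomial_mul, one_mul, add_tsub_cancel_of_le]
          exact Finsupp.single_le_iff.2 h0
        rw [h1, map_mul, h, zero_mul]
      have hX' : bGrading hW (2 * hW.weights 0) ≠ ⊥ := by
        intro h
        apply hX
        rw [← Submodule.mem_bot ℂ, ← h]
        refine Submodule.subset_span ⟨Finsupp.single 0 1, ?_, rfl⟩
        simp
      have h1 := hdeg _ (mul_pos two_pos (hq 0)) hX'
      rw [Fin.sum_univ_two] at ha
      have h2 : 0 ≤ (a 1 : ℝ) * (hW.weights 1 : ℝ) := mul_nonneg (Nat.cast_nonneg _) (hq 1).le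
      have h3 : (a 0 : ℝ) * (4 / n) ≤ 2 - 4 / n := by
        have := mul_le_mul_of_nonneg_left h1 (Nat.cast_nonneg (α := ℝ) (a 0))
        linarith
      have h4 : ((a 0 : ℝ) + 1) * 2 ≤ n := by
        have h5 : ((a 0 : ℝ) + 1) * 4 / n ≤ 2 := by
          have : ((a 0 : ℝ) + 1) * 4 / n = (a 0 : ℝ) * (4 / n) + 4 / n := by ring
          linarith
        rw [div_le_iff₀ hn0] at h5
        linarith
      have h6 : (a 0 + 1) * 2 ≤ n := by exact_mod_cast h4
      omega
    have hex : ∃ b, P (a 0) b := ⟨a, rfl, ha⟩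
    have heq : hex.choose = a := by
      obtain ⟨h0, h1⟩ := hex.choose_spec
      rw [Fin.sum_univ_two] at h1 ha
      rw [h0] at h1
      have h2 : ((hex.choose 1 : ℕ) : ℝ) = a 1 := by
        apply mul_right_cancel₀ (hq 1).ne'
        linarith
      ext i
      fin_cases i
      · exact h0
      · exact_mod_cast h2
    refine Submodule.subset_span ?_
    rw [Finset.mem_coe, Finset.mem_image]
    refine ⟨a 0, Finset.mem_range.2 hle, ?_⟩
    rw [hf]
    simp only [hex, dif_pos, heq]
  have h := linearIndependent_le_span' v hv _ hspan
  rw [Cardinal.mk_fin] at h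
  have h' : m ≤ Fintype.card
      (((Finset.range (n / 2)).image f : Finset (BModel W)) : Set (BModel W)) := by
    exact_mod_cast h
  calc m ≤ ((Finset.range (n / 2)).image f).card := by
        simpa only [Finset.coe_sort_coe, Fintype.card_coe] using h'
    _ ≤ n / 2 := Finset.card_image_le.trans (Finset.card_range _).le

/-- The exponents of the monomials of degree `n - 2` in the variables fixed by the identity. -/
def untwistedExponent (n : ℕ) (k : Fin (n - 1)) : fixedLocus (1 : Fin 2 → ℂˣ) →₀ ℕ :=
  Finsupp.single ⟨0, by simp [fixedLocus]⟩ (k : ℕ) +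
    Finsupp.single ⟨1, by simp [fixedLocus]⟩ (n - 2 - k)

theorem degree_untwistedExponent {n : ℕ} (k : Fin (n - 1)) :
    (untwistedExponent n k).degree = n - 2 := by
  have := k.2
  rw [untwistedExponent, map_add, Finsupp.degree_single, Finsupp.degree_single]
  omega

theorem untwistedExponent_injective (n : ℕ) : Function.Injective (untwistedExponent n) := by
  intro k l h
  have := DFunLike.congr_fun h ⟨0, by simp [fixedLocus]⟩
  simpa [untwistedExponent, Fin.ext_iff] using this

theorem exists_linearIndependent_aGrading {n : ℕ} (hn : 2 ≤ n) {W : MvPolynomial (Fin 2) ℂ}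
    (hW : IsAdmissible W) (hq : hW.weights = fun _ => 1 / (n : ℚ))
    (hG : maxSymmetryGroup W = Subgroup.zpowers (expElement hW.weights)) :
    ∃ v : Fin (n - 1) → AModel W ⊤, LinearIndependent ℂ v ∧
      ∀ i, v i ∈ aGrading hW ⊤ (2 - 4 / n) := by
  classical
  have hhom : W.IsHomogeneous n := isHomogeneous_of_weights (by omega) (hq ▸ hW.hasWeights.2)
  -- The identity sector alone suffices: only a lower bound for the dimension is needed, so other
  -- sectors of the same degree can be ignored.
  let g : (⊤ : Subgroup (maxSymmetryGroup W)) := 1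
  have hmem : ∀ k, Ideal.Quotient.mk (jacobianIdeal (restrictFix (1 : Fin 2 → ℂˣ) W))
      (monomial (untwistedExponent n k) 1) ∈ sector W ⊤ g.1.1 := by
    intro k
    refine mk_monomial_mem_sector fun h _ => ?_
    obtain ⟨z, hz, hzeq⟩ := exists_eq_const_of_mem_zpowers (by omega : n ≠ 0)
      (hq ▸ hG ▸ h.2 : h.1 ∈ Subgroup.zpowers (expElement fun _ : Fin 2 => 1 / (n : ℚ)))
    have hcard : Fintype.card (fixedLocus (1 : Fin 2 → ℂˣ)) = 2 := by
      rw [Fintype.card_coe, fixedLocus_one]; rfl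
    have h1 : ∏ _i : fixedLocus (1 : Fin 2 → ℂˣ), (z : ℂ) = z ^ 2 := by
      rw [Finset.prod_const, Finset.card_univ, hcard]
    have h2 : (untwistedExponent n k).prod (fun _ j => (z : ℂ) ^ j) = z ^ (n - 2) := by
      rw [Finsupp.prod, Finset.prod_pow_eq_pow_sum, ← degree_untwistedExponent k]; rfl
    rw [hzeq]
    refine (congrArg₂ (· * ·) h1 h2).trans ?_
    rw [← pow_add, show 2 + (n - 2) = n by omega, ← Units.val_pow_eq_pow_val, hz, Units.val_one]
  have hli := linearIndependent_mk_monomial (isHomogeneous_restrictFix hhom (1 : Fin 2 → ℂˣ))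
    (untwistedExponent_injective n) (fun k => by rw [degree_untwistedExponent]; omega)
  let u : Fin (n - 1) → sector W ⊤ g.1.1 := fun k => ⟨_, hmem k⟩
  have hu : LinearIndependent ℂ u := LinearIndependent.of_comp (sector W ⊤ g.1.1).subtype hli
  refine ⟨fun k => DirectSum.lof ℂ _ (fun g : (⊤ : Subgroup (maxSymmetryGroup W)) =>
    sector W ⊤ g.1.1) g (u k), ?_, ?_⟩
  · refine LinearIndependent.of_comp (DirectSum.component ℂ _ _ g) ?_
    convert hu using 1
    funext k
    exact DirectSum.component.lof_self ℂ _ _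
  · intro k g' hg'
    have : g' = g := by
      by_contra hne
      exact hg' (DirectSum.of_eq_of_ne _ _ _ hne)
    subst this
    have h1 : (g.1.1 : Fin 2 → ℂˣ) = 1 := rfl
    rw [h1, aDegree, fixedLocus_one, hq, Fin.sum_univ_two]
    simp only [Pi.one_apply, phase_one]
    simp
    ring

theorem not_isMirror {n : ℕ} (hn : 3 < n) {W WT : MvPolynomial (Fin 2) ℂ}
    (hW : IsAdmissible W) (hq : hW.weights = fun _ => 1 / (n : ℚ))
    (hG : maxSymmetryGroup W = Subgroup.zpowers (expElement hW.weights))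
    (hWT : IsAdmissible WT) : ¬ IsMirror hW hWT := by
  rintro ⟨e, he⟩
  obtain ⟨v, hv, hmem⟩ := exists_linearIndependent_aGrading (by omega) hW hq hG
  -- The degree gap passes through `e`: a nonzero graded piece of the B-model comes from some sector
  -- of that degree.
  have hdeg : ∀ d : ℝ, 0 < d → bGrading hWT d ≠ ⊥ → 4 / (n : ℝ) ≤ d := by
    intro d hd hne
    rw [← he d] at hne
    have hne' : aGrading hW ⊤ d ≠ ⊥ := fun h => hne (by rw [h, Submodule.map_bot])
    obtain ⟨x, hx, hx0⟩ := Submodule.exists_mem_ne_zero_of_ne_bot hne'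
    obtain ⟨g, hg⟩ : ∃ g, x g ≠ 0 := by
      by_contra! h
      exact hx0 (DFinsupp.ext h)
    have hgd := hx g hg
    obtain ⟨z, hz, hzeq⟩ := exists_eq_const_of_mem_zpowers (by omega : n ≠ 0)
      (hq ▸ hG ▸ g.1.2 : g.1.1 ∈ Subgroup.zpowers (expElement fun _ : Fin 2 => 1 / (n : ℚ)))
    rw [hq, hzeq] at hgd
    rw [← hgd] at hd ⊢
    exact four_div_le_aDegree hn hz hd
  have h := card_le_of_linearIndependent_bGrading hn hWT hdeg
    (v := fun i => e (v i)) (LinearIndependent.of_comp e.symm.toLinearMap (by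
      convert hv using 1
      funext i
      exact e.symm_apply_apply _))
    (fun i => by
      rw [← he]
      exact Submodule.mem_map_of_mem (hmem i))
  -- The two bounds give `n - 1 ≤ n / 2`, impossible for `n > 3`.
  omega

end TwoVariables

/-! ### The family `x ^ n + y ^ n + x ^ (n - 1) * y`. -/

section Example

/-- The polynomial `x ^ n + y ^ n + x ^ (n - 1) * y`. -/
def fermatPerturbation (n : ℕ) : MvPolynomial (Fin 2) ℂ :=
  X 0 ^ n + X 1 ^ n + X 0 ^ (n - 1) * X 1

theorem fermatPerturbation_eq (n : ℕ) : fermatPerturbation n =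
    monomial (Finsupp.single 0 n) 1 + monomial (Finsupp.single 1 n) 1 +
      monomial (Finsupp.single 0 (n - 1) + Finsupp.single 1 1) 1 := by
  rw [fermatPerturbation, X_pow_eq_monomial, X_pow_eq_monomial, X_pow_eq_monomial, X,
    monomial_mul, one_mul]

theorem support_sum_of_three_monomials {σ : Type} [DecidableEq σ] {a b c : σ →₀ ℕ} (hab : a ≠ b)
    (hac : a ≠ c) (hbc : b ≠ c) :
    (monomial a 1 + monomial b 1 + monomial c 1 : MvPolynomial σ ℂ).support = {a, b, c} := by
  ext m
  rw [mem_support_iff]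
  simp only [coeff_add, coeff_monomial, Finset.mem_insert, Finset.mem_singleton]
  by_cases e1 : m = a
  · subst e1; simp [hab.symm, hac.symm]
  by_cases e2 : m = b
  · subst e2; simp [hab, hbc.symm]
  by_cases e3 : m = c
  · subst e3; simp [hac, hbc]
  simp [e1, e2, e3, Ne.symm e1, Ne.symm e2, Ne.symm e3]

theorem fermatPerturbation_exponents_ne {n : ℕ} (hn : 3 ≤ n) :
    (Finsupp.single 0 n : Fin 2 →₀ ℕ) ≠ Finsupp.single 1 n ∧
      (Finsupp.single 0 n : Fin 2 →₀ ℕ) ≠ Finsupp.single 0 (n - 1) + Finsupp.single 1 1 ∧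
      (Finsupp.single 1 n : Fin 2 →₀ ℕ) ≠ Finsupp.single 0 (n - 1) + Finsupp.single 1 1 := by
  refine ⟨fun h => ?_, fun h => ?_, fun h => ?_⟩
  · have := DFunLike.congr_fun h 0
    simp at this
    omega
  · have := DFunLike.congr_fun h 1
    simp at this
  · have := DFunLike.congr_fun h 1
    simp at this
    omega

theorem support_fermatPerturbation {n : ℕ} (hn : 3 ≤ n) : (fermatPerturbation n).support =
    {Finsupp.single 0 n, Finsupp.single 1 n, Finsupp.single 0 (n - 1) + Finsupp.single 1 1} := by
  obtain ⟨h1, h2, h3⟩ := fermatPerturbation_exponents_ne hn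
  rw [fermatPerturbation_eq, support_sum_of_three_monomials h1 h2 h3]

theorem card_support_fermatPerturbation {n : ℕ} (hn : 3 ≤ n) :
    (fermatPerturbation n).support.card = 3 := by
  obtain ⟨h1, h2, h3⟩ := fermatPerturbation_exponents_ne hn
  rw [support_fermatPerturbation hn]
  exact Finset.card_eq_three.2 ⟨_, _, _, h1, h2, h3, rfl⟩

theorem eval_pderiv_zero_fermatPerturbation (n : ℕ) (x : Fin 2 → ℂ) :
    eval x (pderiv 0 (fermatPerturbation n)) =
      n * x 0 ^ (n - 1) + (n - 1 : ℕ) * x 0 ^ (n - 1 - 1) * x 1 := by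
  simp [fermatPerturbation]
  ring

theorem eval_pderiv_one_fermatPerturbation (n : ℕ) (x : Fin 2 → ℂ) :
    eval x (pderiv 1 (fermatPerturbation n)) = n * x 1 ^ (n - 1) + x 0 ^ (n - 1) := by
  simp [fermatPerturbation]

theorem isNondegenerate_fermatPerturbation {n : ℕ} (hn : 3 ≤ n) :
    IsNondegenerate (fermatPerturbation n) := by
  refine ⟨?_, ?_⟩
  · intro i
    fin_cases i
    · have := eval_pderiv_zero_fermatPerturbation n 0
      simpa [show n - 1 ≠ 0 by omega, show n - 1 - 1 ≠ 0 by omega] using this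
    · have := eval_pderiv_one_fermatPerturbation n 0
      simpa [show n - 1 ≠ 0 by omega, show n - 1 - 1 ≠ 0 by omega] using this
  refine eventually_nhdsWithin_of_forall fun x hx => ?_
  by_contra! h
  apply hx
  have e0 := h 0
  have e1 := h 1
  rw [eval_pderiv_zero_fermatPerturbation] at e0
  rw [eval_pderiv_one_fermatPerturbation] at e1
  obtain ⟨k, rfl⟩ : ∃ k, n = k + 3 := ⟨n - 3, by omega⟩
  simp only [show k + 3 - 1 = k + 2 by omega, show k + 2 - 1 = k + 1 by omega] at e0 e1
  -- If `x 0 ≠ 0`, the first equation gives `n * x 0 = -(n - 1) * x 1`, hence `‖x 0‖ ≤ ‖x 1‖`, while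
  -- the second gives `n * ‖x 1‖ ^ (n - 1) = ‖x 0‖ ^ (n - 1)`, which is incompatible. Thus the
  -- origin is the only critical point, not just an isolated one.
  have hx0 : x 0 = 0 := by
    by_contra hx0
    have h1 : ((k + 3 : ℕ) : ℂ) * x 0 + ((k + 2 : ℕ) : ℂ) * x 1 = 0 := by
      apply mul_left_cancel₀ (pow_ne_zero (k + 1) hx0)
      rw [mul_zero, ← e0]
      ring
    have h2 : ‖((k + 2 : ℕ) : ℂ) * x 1‖ = ‖((k + 3 : ℕ) : ℂ) * x 0‖ := by
      rw [← norm_neg, eq_neg_of_add_eq_zero_left h1]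
    rw [norm_mul, norm_mul, Complex.norm_natCast, Complex.norm_natCast] at h2
    have h3 : ‖((k + 3 : ℕ) : ℂ) * x 1 ^ (k + 2)‖ = ‖x 0 ^ (k + 2)‖ := by
      rw [← norm_neg (x 0 ^ (k + 2)), eq_neg_of_add_eq_zero_left e1]
    rw [norm_mul, norm_pow, norm_pow, Complex.norm_natCast] at h3
    have hp : 0 < ‖x 0‖ := norm_pos_iff.2 hx0
    have h4 : ‖x 0‖ ≤ ‖x 1‖ := by
      push_cast at h2
      have hk : (0 : ℝ) ≤ k := Nat.cast_nonneg k
      nlinarith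
    have h5 : ‖x 0‖ ^ (k + 2) ≤ ‖x 1‖ ^ (k + 2) := pow_le_pow_left₀ hp.le h4 _
    have h6 : 0 < ‖x 0‖ ^ (k + 2) := pow_pos hp _
    push_cast at h3
    have hk : (0 : ℝ) ≤ k := Nat.cast_nonneg k
    nlinarith
  rw [hx0, zero_pow (by omega), add_zero] at e1
  have hx1 : x 1 = 0 := by
    have : ((k + 3 : ℕ) : ℂ) ≠ 0 := by exact_mod_cast (by omega : k + 3 ≠ 0)
    exact eq_zero_of_pow_eq_zero ((mul_eq_zero.1 e1).resolve_left this)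
  rw [Set.mem_singleton_iff]
  funext i
  fin_cases i
  · exact hx0
  · exact hx1

theorem hasWeights_fermatPerturbation_iff {n : ℕ} (hn : 3 ≤ n) (q : Fin 2 → ℚ) :
    HasWeights (fermatPerturbation n) q ↔ q = fun _ => 1 / (n : ℚ) := by
  have hn0 : (n : ℚ) ≠ 0 := by exact_mod_cast (by omega : n ≠ 0)
  have hsupp : ∀ d, coeff d (fermatPerturbation n) ≠ 0 ↔ d = Finsupp.single 0 n ∨
      d = Finsupp.single 1 n ∨ d = Finsupp.single 0 (n - 1) + Finsupp.single 1 1 := by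
    intro d
    rw [← mem_support_iff, support_fermatPerturbation hn]
    simp
  have hw : ∀ (r : Fin 2 → ℚ) (i : Fin 2) (k : ℕ),
      Finsupp.weight r (Finsupp.single i k) = k * r i := by
    intro r i k
    rw [Finsupp.weight_apply, Finsupp.sum_single_index (by simp), nsmul_eq_mul]
  constructor
  · rintro ⟨-, h⟩
    have h0 := h ((hsupp _).2 (Or.inl rfl))
    have h1 := h ((hsupp _).2 (Or.inr (Or.inl rfl)))
    rw [hw] at h0 h1
    funext i
    rw [eq_div_iff hn0, mul_comm]
    fin_cases i
    · exact h0
    · exact h1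
  · rintro rfl
    refine ⟨fun i => by positivity, fun d hd => ?_⟩
    rcases (hsupp d).1 hd with rfl | rfl | rfl
    · rw [hw, mul_one_div_cancel hn0]
    · rw [hw, mul_one_div_cancel hn0]
    · rw [map_add, hw, hw, ← add_mul, ← Nat.cast_add, show n - 1 + 1 = n by omega,
        mul_one_div_cancel hn0]

theorem isAdmissible_fermatPerturbation {n : ℕ} (hn : 3 ≤ n) :
    IsAdmissible (fermatPerturbation n) :=
  ⟨isNondegenerate_fermatPerturbation hn, fun _ => 1 / (n : ℚ),
    (hasWeights_fermatPerturbation_iff hn _).2 rfl,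
    fun q hq => (hasWeights_fermatPerturbation_iff hn q).1 hq⟩

/-- A diagonal substitution rescales each coefficient separately, so no cancellation between
monomials can occur. -/
theorem mem_maxSymmetryGroup_iff {σ : Type} {W : MvPolynomial σ ℂ} {ζ : σ → ℂˣ} :
    ζ ∈ maxSymmetryGroup W ↔
      ∀ a ∈ W.support, (a.prod fun i k => (ζ i : ℂ) ^ k) = 1 := by
  have h : ζ ∈ maxSymmetryGroup W ↔ diagSubst ζ W = W := Iff.rfl
  rw [h, MvPolynomial.ext_iff]
  refine forall_congr' fun a => ?_
  rw [coeff_diagSubst, mem_support_iff]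
  by_cases ha : coeff a W = 0
  · simp [ha]
  · simp [ha]

theorem const_mem_zpowers_expElement {σ : Type} {n : ℕ} (hn : n ≠ 0) {z : ℂˣ} (hz : z ^ n = 1) :
    (fun _ => z) ∈ Subgroup.zpowers (expElement fun _ : σ => 1 / (n : ℚ)) := by
  have : NeZero n := ⟨hn⟩
  have hz' : (z : ℂ) ^ n = 1 := by rw [← Units.val_pow_eq_pow_val, hz, Units.val_one]
  obtain ⟨k, -, hk⟩ := (Complex.isPrimitiveRoot_exp n hn).eq_pow_of_pow_eq_one hz'
  refine Subgroup.mem_zpowers_iff.2 ⟨k, ?_⟩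
  funext i
  ext
  rw [zpow_natCast, Pi.pow_apply, Units.val_pow_eq_pow_val, ← hk]
  simp [expElement, div_eq_mul_inv]

theorem maxSymmetryGroup_fermatPerturbation {n : ℕ} (hn : 3 ≤ n) :
    maxSymmetryGroup (fermatPerturbation n) =
      Subgroup.zpowers (expElement fun _ => 1 / (n : ℚ)) := by
  have hmem : ∀ ζ, ζ ∈ maxSymmetryGroup (fermatPerturbation n) ↔
      ζ 0 ^ n = 1 ∧ ζ 1 ^ n = 1 ∧ ζ 0 ^ (n - 1) * ζ 1 = 1 := by
    intro ζ
    rw [mem_maxSymmetryGroup_iff, support_fermatPerturbation hn]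
    simp only [Finset.mem_insert, Finset.mem_singleton, forall_eq_or_imp, forall_eq, Units.ext_iff]
    rw [Finsupp.prod_add_index' (by simp) (by simp [pow_add])]
    simp
  ext ζ
  constructor
  · intro h
    obtain ⟨h0, -, h2⟩ := (hmem ζ).1 h
    -- The mixed monomial removes the extra symmetries of `x ^ n + y ^ n`: comparing `ζ 0 ^ (n - 1)
    -- * ζ 1 = 1` with `ζ 0 ^ n = 1` forces equal entries.
    have h3 : ζ 1 = ζ 0 := by
      apply mul_left_cancel (a := ζ 0 ^ (n - 1))
      rw [h2, ← pow_succ, show n - 1 + 1 = n by omega, h0]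
    have h4 : ζ = fun _ => ζ 0 := by
      funext i
      fin_cases i
      · rfl
      · exact h3
    rw [h4]
    exact const_mem_zpowers_expElement (by omega) h0
  · intro h
    obtain ⟨z, hz, rfl⟩ := exists_eq_const_of_mem_zpowers (by omega) h
    refine (hmem _).2 ⟨hz, hz, ?_⟩
    rw [← pow_succ, show n - 1 + 1 = n by omega, hz]

end Example

end LandauGinzburg

end

/-! ### Assembly of the three claims. -/

theorem mainTheorem2 :
    -- nonexistence of a two-variable mirror
    (∀ n : ℕ, 3 < n → ∀ (W : MvPolynomial (Fin 2) ℂ) (hW : LandauGinzburg.IsAdmissible W),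
      LandauGinzburg.IsNoninvertible W →
      hW.weights = (fun _ => 1 / (n : ℚ)) →
      LandauGinzburg.maxSymmetryGroup W =
        Subgroup.zpowers (LandauGinzburg.expElement hW.weights) →
      ¬ ∃ (WT : MvPolynomial (Fin 2) ℂ) (hWT : LandauGinzburg.IsAdmissible WT),
        LandauGinzburg.IsMirror hW hWT) ∧
    -- the polynomial `x ^ n + y ^ n + x ^ (n - 1) * y` satisfies the hypotheses
    (∀ n : ℕ, 3 ≤ n → ∀ W : MvPolynomial (Fin 2) ℂ,
      W = MvPolynomial.X 0 ^ n + MvPolynomial.X 1 ^ n +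
        MvPolynomial.X 0 ^ (n - 1) * MvPolynomial.X 1 →
      ∃ hW : LandauGinzburg.IsAdmissible W,
        LandauGinzburg.IsNoninvertible W ∧
        hW.weights = (fun _ => 1 / (n : ℚ)) ∧
        LandauGinzburg.maxSymmetryGroup W =
          Subgroup.zpowers (LandauGinzburg.expElement hW.weights)) ∧
    -- consequently not every admissible polynomial has a mirror in the same number of variables
    ¬ (∀ (N : ℕ) (W : MvPolynomial (Fin N) ℂ) (hW : LandauGinzburg.IsAdmissible W),
      ∃ (WT : MvPolynomial (Fin N) ℂ) (hWT : LandauGinzburg.IsAdmissible WT),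
        LandauGinzburg.IsMirror hW hWT) := by
  have h2 : ∀ n : ℕ, 3 ≤ n → ∀ W : MvPolynomial (Fin 2) ℂ,
      W = MvPolynomial.X 0 ^ n + MvPolynomial.X 1 ^ n +
        MvPolynomial.X 0 ^ (n - 1) * MvPolynomial.X 1 →
      ∃ hW : LandauGinzburg.IsAdmissible W,
        LandauGinzburg.IsNoninvertible W ∧
        hW.weights = (fun _ => 1 / (n : ℚ)) ∧
        LandauGinzburg.maxSymmetryGroup W =
          Subgroup.zpowers (LandauGinzburg.expElement hW.weights) := by
    rintro n hn _ rfl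
    have hW := LandauGinzburg.isAdmissible_fermatPerturbation hn
    have hq := hW.weights_eq ((LandauGinzburg.hasWeights_fermatPerturbation_iff hn _).2 rfl)
    refine ⟨hW, ⟨hW, ?_⟩, hq, ?_⟩
    · have h := LandauGinzburg.card_support_fermatPerturbation hn
      rw [LandauGinzburg.fermatPerturbation] at h
      rw [h, Fintype.card_fin]
      norm_num
    · exact (LandauGinzburg.maxSymmetryGroup_fermatPerturbation hn).trans
        (congrArg (fun q => Subgroup.zpowers (LandauGinzburg.expElement q)) hq.symm)
  refine ⟨?_, h2, ?_⟩
  · rintro n hn W hW - hq hG ⟨WT, hWT, h⟩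
    exact LandauGinzburg.not_isMirror hn hW hq hG hWT h
  · intro hall
    -- The smallest exponent covered by the nonexistence result, `n = 4`, serves as the
    -- counterexample.
    obtain ⟨hW, -, hq, hG⟩ := h2 4 (by norm_num) _ rfl
    obtain ⟨WT, hWT, h⟩ := hall 2 _ hW
    exact LandauGinzburg.not_isMirror (by norm_num) hW hq hG hWT h
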